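/- **Theorem (Approximate Maximin Share).** Let $n\ge 1$ and $m\ge 0$ be integers and let $v:2^{[m]}\to\mathbb R_+$ be a nonnegative, monotone, submodular valuation, that is, $v(\emptyset)=0$, $v(A)\le v(B)$ for $A\subseteq B\subseteq [m]$, and $v(B\cup\{g\})-v(B)\le v(A\cup\{g\})-v(A)$ for $A\subseteq B\subseteq[m]$ and $g\in[m]\setminus B$. Let $$\mu=\max_{(M_1,\dots,M_n)\in\Pi_n(m)}\ \min_{1\le k\le n} v(M_k)$$ be the $n$-maximin share of $v$, where $\Pi_n(m)$ is the set of all partitions of $[m]$ into $n$ labelled, possibly empty, bundles. There are one algorithm and one polynomial $p$, independent of $n$, $m$ and $v$, such that, given $n$, $m$ and access to $v$ through a value oracle only, the algorithm halts after at most $p(n+m)$ steps and returns a partition $(P_1,\dots,P_n)\in\Pi_n(m)$ with $v(P_i)\ge\frac19\mu$ for all $i\in[n]$, together with a real number $\alpha$ with $\frac19\mu\le\alpha\le\mu$. In particular, $(P_1,\dots,P_n)$ is a $\frac19$-approximate maximin fair allocation for $n$ agents who all have the valuation $v$: every agent receives a bundle whose value to her is at least $\frac19$ times her maximin share. Here the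 algorithm is a deterministic random access machine with memory for natural and for real numbers. A step is one oracle call, one memory access, one Boolean operation, one addition, subtraction or comparison of two natural or two real numbers (subtraction of natural numbers being truncated at $0$), or one multiplication of a real number by a fixed rational constant. No product or quotient of two stored numbers and no rounding of real numbers is available. -/

import Mathlib

/-! ## Fair division: valuations, partitions, maximin shares -/

namespace FairDivision

/-- Nonnegative, monotone, submodular valuations of the subsets of `[m]` (with `v(∅) = 0`). -/
structure IsSubmodularValuation {m : ℕ} (v : Finset (Fin m) → ℝ) : Prop where
  nonneg : ∀ S, 0 ≤ v S
  empty : v ∅ = 0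
  mono : ∀ A B, A ⊆ B → v A ≤ v B
  submodular : ∀ A B, A ⊆ B → ∀ g, g ∉ B →
    v (insert g B) - v B ≤ v (insert g A) - v A

/-- `(P_1, …, P_n)` is an `n`-partition of the set of goods `S`; bundles may be empty. -/
def IsPartition {n m : ℕ} (S : Finset (Fin m)) (P : Fin n → Finset (Fin m)) : Prop :=
  (∀ i j, i ≠ j → Disjoint (P i) (P j)) ∧ Finset.univ.biUnion P = S

/-- The `n`-maximin share of the valuation `v` over the goods in `S`: the maximum over all
`n`-partitions of `S` of the value of the least valuable bundle. -/
noncomputable def maximinShare {m : ℕ} (v : Finset (Fin m) → ℝ) (n : ℕ)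
    (S : Finset (Fin m)) : ℝ :=
  ⨆ P : {P : Fin n → Finset (Fin m) // IsPartition S P}, ⨅ k : Fin n, v (P.1 k)

/-- The maximum in the definition of the maximin share is attained. -/
theorem maximinShare_isGreatest {m n : ℕ} (hn : 1 ≤ n) (v : Finset (Fin m) → ℝ)
    (S : Finset (Fin m)) :
    IsGreatest {x : ℝ | ∃ P : Fin n → Finset (Fin m), IsPartition S P ∧ x = ⨅ k, v (P k)}
      (maximinShare v n S) := by
  have : Nonempty {P : Fin n → Finset (Fin m) // IsPartition S P} := by
    refine ⟨⟨fun i => if i = ⟨0, hn⟩ then S else ∅, ?_, ?_⟩⟩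
    · intro i j hij
      by_cases hi : i = ⟨0, hn⟩
      · have hj : j ≠ ⟨0, hn⟩ := fun h => hij (hi.trans h.symm)
        simp [hj]
      · simp [hi]
    · ext x
      simp only [Finset.mem_biUnion, Finset.mem_univ, true_and]
      constructor
      · rintro ⟨i, hi⟩
        split_ifs at hi
        · exact hi
        · simp at hi
      · intro hx
        exact ⟨⟨0, hn⟩, by simpa using hx⟩
  constructor
  · obtain ⟨P, hP⟩ := exists_eq_ciSup_of_finite
      (f := fun P : {P : Fin n → Finset (Fin m) // IsPartition S P} => ⨅ k, v (P.1 k))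
    exact ⟨P.1, P.2, hP.symm⟩
  · rintro x ⟨P, hP, rfl⟩
    exact le_ciSup (f := fun P : {P : Fin n → Finset (Fin m) // IsPartition S P} =>
      ⨅ k, v (P.1 k)) (Set.finite_range _).bddAbove ⟨P, hP⟩

/-- An allocation `P` of all the goods to `n` agents with valuations `u i` is
`c`-approximate maximin fair if every agent gets at least `c` times her maximin share. -/
def IsApproxMaximinFair {n m : ℕ} (c : ℝ) (u : Fin n → Finset (Fin m) → ℝ)
    (P : Fin n → Finset (Fin m)) : Prop :=
  IsPartition Finset.univ P ∧ ∀ i, c * maximinShare (u i) n Finset.univ ≤ u i (P i)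

/-! ## Algorithms with a value oracle

A random access machine, programmed in a structured language.  Its memory consists of arrays of
natural numbers and arrays of real numbers, addressed by arbitrary natural numbers (with indirect
addressing).  On natural numbers it can add, subtract (truncated at `0`) and compare; on reals it
can add, subtract, multiply by a rational constant of the program, and compare.  There is no
multiplication of two stored numbers and no rounding of a real number.  The valuation is available
only through oracle calls.  Every operation and every oracle call costs one step. -/

/-- Expressions with values in the natural numbers. -/
inductive NatExpr : Type
  /-- a constant -/
  | const (c : ℕ)
  /-- the entry number `i` of the array `a` of natural numbers -/
  | get (a : ℕ) (i : NatExpr)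
  | add (e f : NatExpr)
  /-- truncated subtraction -/
  | sub (e f : NatExpr)

/-- Expressions with values in the real numbers. -/
inductive RealExpr : Type
  /-- a rational constant -/
  | const (q : ℚ)
  /-- the entry number `i` of the array `a` of real numbers -/
  | get (a : ℕ) (i : NatExpr)
  | add (e f : RealExpr)
  | sub (e f : RealExpr)
  /-- the product with a rational constant -/
  | scale (q : ℚ) (e : RealExpr)
  /-- the answer of the oracle for the set of those goods `j` whose entry in the array `a` of
  natural numbers is `k` -/
  | value (a : ℕ) (k : NatExpr)

/-- Tests. -/
inductive Test : Type
  | natLe (e f : NatExpr)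
  | realLe (e f : RealExpr)
  | neg (b : Test)
  | and (b c : Test)

/-- Programs. -/
inductive Program : Type
  | skip
  /-- store the value of `e` as entry number `i` of the array `a` of natural numbers -/
  | setNat (a : ℕ) (i : NatExpr) (e : NatExpr)
  /-- store the value of `e` as entry number `i` of the array `a` of real numbers -/
  | setReal (a : ℕ) (i : NatExpr) (e : RealExpr)
  | seq (p q : Program)
  | ite (b : Test) (p q : Program)
  /-- execute `p` as long as `b` holds -/
  | loop (b : Test) (p : Program)

/-- The contents of the memory. -/
structure Memory : Type where
  nat : ℕ → ℕ → ℕ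
  real : ℕ → ℕ → ℝ

namespace Memory

/-- Overwrite one entry of an array of natural numbers. -/
def setNat (s : Memory) (a i x : ℕ) : Memory :=
  { s with nat := Function.update s.nat a (Function.update (s.nat a) i x) }

/-- Overwrite one entry of an array of real numbers. -/
noncomputable def setReal (s : Memory) (a i : ℕ) (x : ℝ) : Memory :=
  { s with real := Function.update s.real a (Function.update (s.real a) i x) }

/-- The set of the goods `j` in `[m]` whose entry in the array `a` is `k`. -/
def goods (s : Memory) (m a k : ℕ) : Finset (Fin m) :=
  Finset.univ.filter fun j : Fin m => s.nat a j = k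

/-- The memory at the start: the number `n` of bundles is entry `0` of the array `0`, the number
`m` of goods is entry `0` of the array `1`, and every other entry is `0`. -/
def initial (n m : ℕ) : Memory where
  nat a i := if a = 0 ∧ i = 0 then n else if a = 1 ∧ i = 0 then m else 0
  real _ _ := 0

/-- The bundles that are returned: entry `j` of the array `2` of natural numbers is the number of
the bundle that good `j` belongs to. -/
def bundles (s : Memory) (n m : ℕ) : Fin n → Finset (Fin m) :=
  fun i => s.goods m 2 i

/-- The real number that is returned: entry `0` of the array `0` of real numbers. -/
def number (s : Memory) : ℝ := s.real 0 0

end Memory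

/-- The value of an expression. -/
def NatExpr.eval (s : Memory) : NatExpr → ℕ
  | .const c => c
  | .get a i => s.nat a (i.eval s)
  | .add e f => e.eval s + f.eval s
  | .sub e f => e.eval s - f.eval s

/-- The value of an expression, where the oracle is the valuation `v`. -/
noncomputable def RealExpr.eval {m : ℕ} (v : Finset (Fin m) → ℝ) (s : Memory) : RealExpr → ℝ
  | .const q => (q : ℝ)
  | .get a i => s.real a (i.eval s)
  | .add e f => e.eval v s + f.eval v s
  | .sub e f => e.eval v s - f.eval v s
  | .scale q e => (q : ℝ) * e.eval v s
  | .value a k => v (s.goods m a (k.eval s))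

/-- The truth of a test, where the oracle is the valuation `v`. -/
def Test.Holds {m : ℕ} (v : Finset (Fin m) → ℝ) (s : Memory) : Test → Prop
  | .natLe e f => e.eval s ≤ f.eval s
  | .realLe e f => e.eval v s ≤ f.eval v s
  | .neg b => ¬ b.Holds v s
  | .and b c => b.Holds v s ∧ c.Holds v s

/-- The number of steps of the evaluation of an expression. -/
def NatExpr.cost : NatExpr → ℕ
  | .const _ => 1
  | .get _ i => i.cost + 1
  | .add e f => e.cost + f.cost + 1
  | .sub e f => e.cost + f.cost + 1

/-- The number of steps of the evaluation of an expression. -/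
def RealExpr.cost : RealExpr → ℕ
  | .const _ => 1
  | .get _ i => i.cost + 1
  | .add e f => e.cost + f.cost + 1
  | .sub e f => e.cost + f.cost + 1
  | .scale _ e => e.cost + 1
  | .value _ k => k.cost + 1

/-- The number of steps of the evaluation of a test. -/
def Test.cost : Test → ℕ
  | .natLe e f => e.cost + f.cost + 1
  | .realLe e f => e.cost + f.cost + 1
  | .neg b => b.cost + 1
  | .and b c => b.cost + c.cost + 1

/-- `Runs v p s s' t`: the program `p`, started with memory `s` and with the oracle `v`, halts after
`t` steps with memory `s'`. -/
inductive Runs {m : ℕ} (v : Finset (Fin m) → ℝ) : Program → Memory → Memory → ℕ → Prop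
  | skip (s : Memory) : Runs v .skip s s 1
  | setNat (s : Memory) (a : ℕ) (i e : NatExpr) :
      Runs v (.setNat a i e) s (s.setNat a (i.eval s) (e.eval s)) (i.cost + e.cost + 1)
  | setReal (s : Memory) (a : ℕ) (i : NatExpr) (e : RealExpr) :
      Runs v (.setReal a i e) s (s.setReal a (i.eval s) (e.eval v s)) (i.cost + e.cost + 1)
  | seq {p q : Program} {s s' s'' : Memory} {t t' : ℕ} :
      Runs v p s s' t → Runs v q s' s'' t' → Runs v (.seq p q) s s'' (t + t')
  | ite_true {b : Test} {p q : Program} {s s' : Memory} {t : ℕ} :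
      b.Holds v s → Runs v p s s' t → Runs v (.ite b p q) s s' (b.cost + t)
  | ite_false {b : Test} {p q : Program} {s s' : Memory} {t : ℕ} :
      ¬ b.Holds v s → Runs v q s s' t → Runs v (.ite b p q) s s' (b.cost + t)
  | loop_done {b : Test} {p : Program} {s : Memory} :
      ¬ b.Holds v s → Runs v (.loop b p) s s b.cost
  | loop_step {b : Test} {p : Program} {s s' s'' : Memory} {t t' : ℕ} :
      b.Holds v s → Runs v p s s' t → Runs v (.loop b p) s' s'' t' →
        Runs v (.loop b p) s s'' (b.cost + t + t')

/-- Programs are deterministic: the final memory and the number of steps are determined. -/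
theorem Runs.unique {m : ℕ} {v : Finset (Fin m) → ℝ} {p : Program} {s s₁ : Memory} {t₁ : ℕ}
    (h₁ : Runs v p s s₁ t₁) :
    ∀ {s₂ : Memory} {t₂ : ℕ}, Runs v p s s₂ t₂ → s₁ = s₂ ∧ t₁ = t₂ := by
  induction h₁ with
  | skip s => intro _ _ h; cases h; exact ⟨rfl, rfl⟩
  | setNat s a i e => intro _ _ h; cases h; exact ⟨rfl, rfl⟩
  | setReal s a i e => intro _ _ h; cases h; exact ⟨rfl, rfl⟩
  | seq _ _ ih ih' =>
    intro _ _ h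
    cases h with
    | seq g g' =>
      obtain ⟨rfl, rfl⟩ := ih g
      obtain ⟨rfl, rfl⟩ := ih' g'
      exact ⟨rfl, rfl⟩
  | ite_true hb _ ih =>
    intro _ _ h
    cases h with
    | ite_true _ g => obtain ⟨rfl, rfl⟩ := ih g; exact ⟨rfl, rfl⟩
    | ite_false hb' _ => exact absurd hb hb'
  | ite_false hb _ ih =>
    intro _ _ h
    cases h with
    | ite_true hb' _ => exact absurd hb' hb
    | ite_false _ g => obtain ⟨rfl, rfl⟩ := ih g; exact ⟨rfl, rfl⟩
  | loop_done hb =>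
    intro _ _ h
    cases h with
    | loop_done _ => exact ⟨rfl, rfl⟩
    | loop_step hb' _ _ => exact absurd hb' hb
  | loop_step hb _ _ ih ih' =>
    intro _ _ h
    cases h with
    | loop_done hb' => exact absurd hb hb'
    | loop_step _ g g' =>
      obtain ⟨rfl, rfl⟩ := ih g
      obtain ⟨rfl, rfl⟩ := ih' g'
      exact ⟨rfl, rfl⟩

end FairDivision

namespace FairDivision

/-! ## Round robin -/

/-! The share μ is unknown to the algorithm. For every k < n it runs a greedy round robin in which
the bundles below k drop out after one turn, and it keeps the labelling whose least bundle is most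
valuable. It suffices that a single k works, and the argument even gives the factor 1/3.

Put τ = μ/3, let B be the set of goods worth at least τ on their own, and let k = min(|B|, n - 1).
Fix a bundle i with final content S. If its first pick is worth at least τ, nothing remains to show.
Otherwise only goods worth less than τ were left at that moment, so the set F of goods taken earlier
contains B. As |F| ≤ i < n, this forces k = |B| ≤ i, and bundle i keeps picking. Each of its gains x
bounds the marginal value, for this bundle, of every good taken before its next turn, and there are
at most n - k - 1 of these. Hence the marginals over S of the goods outside F sum to at most (n - k)
v(S); this is the invariant `RoundRobin.served`.

In an optimal partition a set J of at least n - k bundles avoids B. Bound each v(M_j), j ∈ J, by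
v(S) plus the marginals of its goods, and sum. Goods outside F contribute at most (n - k) v(S), and
the at most n - k goods of F \ B less than τ each. So |J| μ ≤ |J| (2 v(S) + μ/3), that is v(S) ≥ μ/3
(`RoundRobin.share_le`).

The returned number is a lower bound for the bundles of an actual partition, hence at most μ.
Halting and running time come from Hoare-style rules with step bounds (`Achieves`). -/

/-- The goods with label `i`. -/
def bundle {m : ℕ} (L : Fin m → ℕ) (i : ℕ) : Finset (Fin m) :=
  Finset.univ.filter fun j => L j = i

/-- The marginal value of a good. -/
def marginal {m : ℕ} (v : Finset (Fin m) → ℝ) (S : Finset (Fin m)) (g : Fin m) : ℝ :=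
  v (insert g S) - v S

/-- `RoundRobin v n k t L p`: after `t` turns of round robin among the bundles `0, …, n - 1`, in
which the bundles below `k` have only one turn, the labelling is `L` and it is the turn of the
bundle `p`.  Goods labelled `n` are not yet assigned. -/
inductive RoundRobin {m : ℕ} (v : Finset (Fin m) → ℝ) (n k : ℕ) : ℕ → (Fin m → ℕ) → ℕ → Prop
  | start : RoundRobin v n k 0 (fun _ => n) 0
  | turn {t : ℕ} {L : Fin m → ℕ} {p : ℕ} (g : Fin m) :
      RoundRobin v n k t L p → L g = n →
      (∀ g', L g' = n → v (insert g' (bundle L p)) ≤ v (insert g (bundle L p))) →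
      RoundRobin v n k (t + 1) (Function.update L g p) (if n ≤ p + 1 then k else p + 1)

section
variable {m : ℕ} {v : Finset (Fin m) → ℝ}

/-! ### Relabelling a good, and marginal values -/

theorem mem_bundle {L : Fin m → ℕ} {i : ℕ} {g : Fin m} : g ∈ bundle L i ↔ L g = i := by
  simp [bundle]

theorem bundle_update_self {L : Fin m → ℕ} {g : Fin m} {p : ℕ} :
    bundle (Function.update L g p) p = insert g (bundle L p) := by
  ext j
  by_cases h : j = g
  · subst h; simp [mem_bundle]
  · simp [mem_bundle, h]

theorem bundle_update_of_ne {L : Fin m → ℕ} {g : Fin m} {p i : ℕ} (hi : i ≠ p) :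
    bundle (Function.update L g p) i = (bundle L i).erase g := by
  ext j
  by_cases h : j = g
  · subst h; simp [mem_bundle, hi.symm]
  · simp [mem_bundle, h]

theorem bundle_update_other {L : Fin m → ℕ} {g : Fin m} {p i : ℕ} (hi : i ≠ p) (hg : L g ≠ i) :
    bundle (Function.update L g p) i = bundle L i := by
  rw [bundle_update_of_ne hi, Finset.erase_eq_of_notMem (by simpa [mem_bundle] using hg)]

theorem IsSubmodularValuation.marginal_nonneg (hv : IsSubmodularValuation v)
    (S : Finset (Fin m)) (g : Fin m) : 0 ≤ marginal v S g :=
  sub_nonneg.2 (hv.mono _ _ (Finset.subset_insert g S))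

theorem marginal_of_mem {S : Finset (Fin m)} {g : Fin m} (h : g ∈ S) : marginal v S g = 0 := by
  simp [marginal, Finset.insert_eq_of_mem h]

theorem IsSubmodularValuation.marginal_anti (hv : IsSubmodularValuation v)
    {A B : Finset (Fin m)} (h : A ⊆ B) (g : Fin m) : marginal v B g ≤ marginal v A g := by
  by_cases hg : g ∈ B
  · rw [marginal_of_mem hg]; exact hv.marginal_nonneg A g
  · exact hv.submodular A B h g hg

/-- Add the goods of M to S one at a time: by diminishing returns each gains at most its marginal
over S. -/
theorem IsSubmodularValuation.union_le (hv : IsSubmodularValuation v) (S M : Finset (Fin m)) :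
    v (M ∪ S) ≤ v S + ∑ g ∈ M, marginal v S g := by
  induction M using Finset.induction_on with
  | empty => simp
  | insert g M hg ih =>
    rw [Finset.sum_insert hg, Finset.insert_union]
    have := hv.marginal_anti (Finset.subset_union_right : S ⊆ M ∪ S) g
    have h : v (insert g (M ∪ S)) = v (M ∪ S) + marginal v (M ∪ S) g := by simp [marginal]
    linarith

theorem RoundRobin.basic {n k t p : ℕ} {L : Fin m → ℕ} (hk : k < n)
    (h : RoundRobin v n k t L p) :
    p < n ∧ (∀ g, L g ≤ n) ∧ (bundle L n).card + t = m := by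
  induction h with
  | start => exact ⟨by omega, fun _ => le_rfl, by simp [bundle]⟩
  | @turn t L p g _ hg _ ih =>
    obtain ⟨hp, hL, hc⟩ := ih
    refine ⟨by split_ifs <;> omega, fun j => ?_, ?_⟩
    · by_cases hj : j = g
      · subst hj; simpa using hp.le
      · simpa [hj] using hL j
    · have hm : g ∈ bundle L n := mem_bundle.2 hg
      rw [bundle_update_of_ne hp.ne', Finset.card_erase_of_mem hm]
      have := Finset.card_pos.2 ⟨g, hm⟩
      omega

/-! ### The round robin invariant -/

/-- The state of the bundle `i` in a round robin: it still waits for its first turn, or its value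
is at least `τ`, or the value that the goods assigned after its first turn could add to it is
bounded by its own value. -/
def Served (v : Finset (Fin m) → ℝ) (n k : ℕ) (τ : ℝ) (L : Fin m → ℕ) (p i : ℕ) : Prop :=
  (bundle L i = ∅ ∧ m ≤ p + (bundle L n).card ∧ p ≤ i) ∨ τ ≤ v (bundle L i) ∨
  ∃ (F : Finset (Fin m)) (x : ℝ) (d : ℕ), F.card ≤ i ∧ k ≤ i ∧ k ≤ p ∧ (∀ g ∉ F, v {g} < τ) ∧
    (i < p → d + p = n - k + i) ∧ (p ≤ i → p + d = i) ∧
    0 ≤ x ∧ (∀ g ∈ bundle L n, marginal v (bundle L i) g ≤ x) ∧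
    ∑ g ∈ Finset.univ.filter (fun g => g ∉ F ∧ L g ≠ n), marginal v (bundle L i) g + d * x ≤
      ((n - k : ℕ) : ℝ) * v (bundle L i)

/-- Only g can become newly assigned. The bound need not be an equality, since g may lie in F or be
counted already. -/
theorem sum_assigned_update_le (hv : IsSubmodularValuation v) {n p : ℕ} {L : Fin m → ℕ}
    (F S : Finset (Fin m)) (g : Fin m) :
    ∑ j ∈ Finset.univ.filter (fun j => j ∉ F ∧ Function.update L g p j ≠ n), marginal v S j ≤
      ∑ j ∈ Finset.univ.filter (fun j => j ∉ F ∧ L j ≠ n), marginal v S j + marginal v S g := by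
  set A := Finset.univ.filter (fun j => j ∉ F ∧ L j ≠ n)
  have hsub : Finset.univ.filter (fun j => j ∉ F ∧ Function.update L g p j ≠ n) ⊆ insert g A := by
    intro j hj
    by_cases h : j = g
    · simp [h]
    · simpa [A, h] using hj
  refine (Finset.sum_le_sum_of_subset_of_nonneg hsub
    fun j _ _ => hv.marginal_nonneg S j).trans ?_
  by_cases h : g ∈ A
  · rw [Finset.insert_eq_of_mem h]
    linarith [hv.marginal_nonneg S g]
  · rw [Finset.sum_insert h, add_comm]

/-- Amortization: a gain x raises the right-hand side of the invariant by (n - k) x. This prepays x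
for each of the n - k - 1 turns of other bundles before the next own turn. The picked good itself
costs nothing, as its marginal is now 0, and the old marginals only shrink. -/
theorem Served.own_turn (hv : IsSubmodularValuation v) {n k i : ℕ} {τ : ℝ} {L : Fin m → ℕ}
    {g : Fin m} (hi : i < n) (hki : k ≤ i)
    (hmax : ∀ g', L g' = n → v (insert g' (bundle L i)) ≤ v (insert g (bundle L i)))
    {F : Finset (Fin m)} (hF : F.card ≤ i) (hsmall : ∀ g ∉ F, v {g} < τ)
    (hsum : ∑ j ∈ Finset.univ.filter (fun j => j ∉ F ∧ L j ≠ n), marginal v (bundle L i) j ≤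
      ((n - k : ℕ) : ℝ) * v (bundle L i)) :
    Served v n k τ (Function.update L g i) (if n ≤ i + 1 then k else i + 1) i := by
  refine Or.inr (Or.inr ⟨F, marginal v (bundle L i) g, n - k - 1, hF, hki, ?_, hsmall, ?_, ?_,
    hv.marginal_nonneg _ _, ?_, ?_⟩)
  · split_ifs <;> omega
  · split_ifs <;> omega
  · split_ifs <;> omega
  · intro j hj
    rw [bundle_update_of_ne hi.ne'] at hj
    rw [bundle_update_self]
    have hj' := mem_bundle.1 (Finset.mem_of_mem_erase hj)
    refine (hv.marginal_anti (Finset.subset_insert _ _) j).trans ?_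
    simp only [marginal]
    linarith [hmax j hj']
  · have h1 := sum_assigned_update_le hv (n := n) (p := i) (L := L) F
      (insert g (bundle L i)) g
    rw [marginal_of_mem (Finset.mem_insert_self _ _)] at h1
    have h2 : ∑ j ∈ Finset.univ.filter (fun j => j ∉ F ∧ L j ≠ n),
        marginal v (insert g (bundle L i)) j ≤ _ :=
      Finset.sum_le_sum fun j _ => hv.marginal_anti (Finset.subset_insert g (bundle L i)) j
    rw [bundle_update_self]
    have h3 : v (insert g (bundle L i)) = v (bundle L i) + marginal v (bundle L i) g := by
      simp [marginal]
    have h4 : ((n - k : ℕ) : ℝ) = ((n - k - 1 : ℕ) : ℝ) + 1 := by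
      rw [← Nat.cast_succ]; congr 1; omega
    rw [h3]
    have h5 := hv.marginal_nonneg (bundle L i) g
    rw [h4] at hsum ⊢
    linarith

theorem RoundRobin.served (hv : IsSubmodularValuation v) {n k t p : ℕ} {τ : ℝ}
    {L : Fin m → ℕ} (hk : k < n)
    (hbig : k ≤ (Finset.univ.filter fun g : Fin m => τ ≤ v {g}).card)
    (h : RoundRobin v n k t L p) : ∀ i < n, Served v n k τ L p i := by
  induction h with
  | start =>
    intro i hi
    exact Or.inl ⟨by simp [bundle, hi.ne'], by simp [bundle], Nat.zero_le i⟩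
  | @turn t L p g hR hg hmax ih =>
    intro i hi
    obtain ⟨hp, hL, hc⟩ := hR.basic hk
    have hgm : g ∈ bundle L n := mem_bundle.2 hg
    have hpos := Finset.card_pos.2 ⟨g, hgm⟩
    by_cases hip : i = p
    · subst hip
      rcases ih i hi with ⟨he, hm, -⟩ | hτ | ⟨F, x, d, hF, hki, -, hsmall, -, hd, -, -, hsum⟩
      · by_cases hlt : τ ≤ v {g}
        · refine Or.inr (Or.inl ?_)
          rw [bundle_update_self, he]
          simpa using hlt
        -- The bundle is empty, so the greedy pick is the best single good left; if it is below τ,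
        -- so are all unassigned goods. F is the set of goods already assigned. It contains every
        -- good worth at least τ, which yields k ≤ i.
        · have hsmall : ∀ j ∉ (bundle L n)ᶜ, v {j} < τ := by
            intro j hj
            have := hmax j (mem_bundle.1 (by simpa using hj))
            rw [he] at this
            simp only [insert_empty_eq] at this
            linarith
          have hF : ((bundle L n)ᶜ).card ≤ i := by
            rw [Finset.card_compl, Fintype.card_fin]; omega
          refine Served.own_turn hv hi ?_ hmax hF hsmall ?_
          · refine hbig.trans (le_trans (Finset.card_le_card fun j hj => ?_) hF)
            by_contra hj'
            exact absurd (hsmall j hj') (not_lt.2 (by simpa using hj))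
          · rw [Finset.sum_eq_zero]
            · exact mul_nonneg (Nat.cast_nonneg _) (hv.nonneg _)
            · intro j hj
              simp [mem_bundle] at hj
      · refine Or.inr (Or.inl (hτ.trans ?_))
        rw [bundle_update_self]
        exact hv.mono _ _ (Finset.subset_insert _ _)
      · have hd0 : d = 0 := by have := hd le_rfl; omega
        subst hd0
        exact Served.own_turn hv hi hki hmax hF hsmall (by simpa using hsum)
    · have hb : bundle (Function.update L g p) i = bundle L i :=
        bundle_update_other hip (by omega)
      have hn : bundle (Function.update L g p) n = (bundle L n).erase g :=
        bundle_update_of_ne hp.ne'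
      rcases ih i hi with ⟨he, hm, hpi⟩ | hτ | ⟨F, x, d, hF, hki, hkp, hsmall, hd1, hd2, hx0, hx, hsum⟩
      · refine Or.inl ⟨hb.trans he, ?_, ?_⟩
        · rw [hn, Finset.card_erase_of_mem hgm, if_neg (by omega)]
          omega
        · rw [if_neg (by omega)]; omega
      · exact Or.inr (Or.inl (by rwa [hb]))
      -- Another bundle moves while i waits, so d is positive, and one prepaid x covers the marginal
      -- of the good taken.
      · obtain ⟨e, rfl⟩ : ∃ e, d = e + 1 := Nat.exists_eq_add_of_le' (by omega)
        refine Or.inr (Or.inr ⟨F, x, e, hF, hki, ?_, hsmall, ?_, ?_, hx0, ?_, ?_⟩)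
        · split_ifs <;> omega
        · split_ifs <;> omega
        · split_ifs <;> omega
        · intro j hj
          rw [hb]
          rw [hn] at hj
          exact hx j (Finset.mem_of_mem_erase hj)
        · rw [hb]
          have h1 := sum_assigned_update_le hv (n := n) (p := p) (L := L) F (bundle L i) g
          have h2 := hx g hgm
          push_cast at hsum
          linarith

/-! ### From the invariant to a third of the maximin share -/

theorem card_filter_disjoint_add_card_le {n : ℕ} {M : Fin n → Finset (Fin m)}
    (hM : ∀ i j, i ≠ j → Disjoint (M i) (M j)) (B : Finset (Fin m)) :
    n ≤ (Finset.univ.filter fun j => Disjoint (M j) B).card + B.card := by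
  have h1 := Finset.card_filter_add_card_filter_not (s := (Finset.univ : Finset (Fin n)))
    (fun j => Disjoint (M j) B)
  have h2 : (Finset.univ.filter fun j => ¬ Disjoint (M j) B).card ≤ B.card := by
    rcases isEmpty_or_nonempty (Fin m) with hm | hm
    · simp [Finset.eq_empty_of_isEmpty]
    have hex : ∀ j ∈ Finset.univ.filter (fun j => ¬ Disjoint (M j) B), ∃ g, g ∈ M j ∧ g ∈ B := by
      intro j hj
      simpa using Finset.not_disjoint_iff.1 (Finset.mem_filter.1 hj).2
    choose! f hf using hex
    -- Choosing a common element with B is injective on the bundles that meet B, because the bundles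
    -- are disjoint.
    refine Finset.card_le_card_of_injOn f (fun j hj => (hf j hj).2) ?_
    intro i hi j hj hij
    by_contra hne
    exact Finset.disjoint_left.1 (hM i j hne) (hf i hi).1 (hij ▸ (hf j hj).1)
  simp only [Finset.card_univ, Fintype.card_fin] at h1
  omega

theorem RoundRobin.share_le (hv : IsSubmodularValuation v) {n k p : ℕ} {L : Fin m → ℕ} {μ : ℝ}
    {M : Fin n → Finset (Fin m)} (hM : ∀ i j, i ≠ j → Disjoint (M i) (M j)) (hμ : ∀ j, μ ≤ v (M j))
    (hn : 1 ≤ n)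
    (hk : k = min (Finset.univ.filter fun g : Fin m => μ / 3 ≤ v {g}).card (n - 1))
    (h : RoundRobin v n k m L p) {i : ℕ} (hi : i < n) : μ / 3 ≤ v (bundle L i) := by
  set B := Finset.univ.filter fun g : Fin m => μ / 3 ≤ v {g} with hB
  have hkn : k < n := by omega
  obtain ⟨hp, hL, hc⟩ := h.basic hkn
  have hempty : bundle L n = ∅ := by rw [← Finset.card_eq_zero]; omega
  have key : μ / 3 ≤ v (bundle L i) ∨ ∃ F : Finset (Fin m), F.card ≤ i ∧ B ⊆ F ∧
      ∑ g ∈ Fᶜ, marginal v (bundle L i) g ≤ ((n - k : ℕ) : ℝ) * v (bundle L i) := by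
    rcases h.served hv (τ := μ / 3) hkn (hk ▸ min_le_left _ _) i hi with
      ⟨he, hm, hpi⟩ | hτ | ⟨F, x, d, hF, -, -, hsmall, -, -, hx, -, hsum⟩
    -- Bundle i never had a turn: the goods ran out first, so m ≤ i and F may be the set of all
    -- goods.
    · refine Or.inr ⟨Finset.univ, ?_, Finset.subset_univ _, ?_⟩
      · rw [hempty] at hm
        simp at hm ⊢
        omega
      · simp only [Finset.compl_univ, Finset.sum_empty]
        exact mul_nonneg (Nat.cast_nonneg _) (hv.nonneg _)
    · exact Or.inl hτ
    · refine Or.inr ⟨F, hF, ?_, ?_⟩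
      · intro j hj
        by_contra hj'
        exact absurd (hsmall j hj') (not_lt.2 (by simpa [hB] using hj))
      · have : Finset.univ.filter (fun g => g ∉ F ∧ L g ≠ n) = Fᶜ := by
          ext j
          have : L j ≠ n := fun h => by
            have := mem_bundle.2 h
            rw [hempty] at this
            simp at this
          simp [this]
        rw [this] at hsum
        have : (0 : ℝ) ≤ d * x := mul_nonneg (Nat.cast_nonneg _) hx
        linarith
  rcases key with h | ⟨F, hF, hBF, hsum⟩
  · exact h
  have hBc := Finset.card_le_card hBF
  -- Here |B| ≤ |F| ≤ i ≤ n - 1, so the minimum defining k is attained by |B|.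
  have hkB : k = B.card := by omega
  set S := bundle L i
  set J := Finset.univ.filter fun j => Disjoint (M j) B with hJ
  have hJc : n - k ≤ J.card := by
    have : n ≤ J.card + B.card := card_filter_disjoint_add_card_le hM B
    omega
  have hcast : ((n - k : ℕ) : ℝ) ≤ J.card := by exact_mod_cast hJc
  have hpos : (0 : ℝ) < ((n - k : ℕ) : ℝ) := by exact_mod_cast (by omega : 0 < n - k)
  have h1 : (J.card : ℝ) * μ ≤ ∑ j ∈ J, v (M j) := by
    rw [← nsmul_eq_mul]
    exact Finset.card_nsmul_le_sum _ _ _ fun j _ => hμ j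
  have h2 : ∑ j ∈ J, v (M j) ≤ J.card * v S + ∑ j ∈ J, ∑ g ∈ M j, marginal v S g := by
    rw [← nsmul_eq_mul, ← Finset.sum_const, ← Finset.sum_add_distrib]
    exact Finset.sum_le_sum fun j _ =>
      (hv.mono _ _ Finset.subset_union_left).trans (hv.union_le S (M j))
  have h3 : ∑ j ∈ J, ∑ g ∈ M j, marginal v S g ≤ ∑ g ∈ Bᶜ, marginal v S g := by
    rw [← Finset.sum_biUnion fun a _ b _ hab => hM a b hab]
    refine Finset.sum_le_sum_of_subset_of_nonneg ?_ fun g _ _ => hv.marginal_nonneg S g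
    intro g hg
    obtain ⟨j, hj, hgj⟩ := Finset.mem_biUnion.1 hg
    exact Finset.mem_compl.2 (Finset.disjoint_left.1 (Finset.mem_filter.1 hj).2 hgj)
  have h4 : ∑ g ∈ Bᶜ, marginal v S g ≤ ∑ g ∈ Fᶜ, marginal v S g + ∑ g ∈ F \ B, marginal v S g := by
    rw [← Finset.sum_union]
    · refine Finset.sum_le_sum_of_subset_of_nonneg ?_ fun g _ _ => hv.marginal_nonneg S g
      intro g hg
      by_cases hgF : g ∈ F <;> simp_all
    · exact Finset.disjoint_left.2 fun g hg hg' =>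
        Finset.mem_compl.1 hg (Finset.mem_sdiff.1 hg').1
  have hμ0 : 0 ≤ μ / 3 ∨ μ / 3 < 0 := le_or_gt _ _
  rcases hμ0 with hμ0 | hμ0
  swap
  · exact hμ0.le.trans (hv.nonneg _)
  have h5 : ∑ g ∈ F \ B, marginal v S g ≤ ((n - k : ℕ) : ℝ) * (μ / 3) := by
    have hle : ∀ g ∈ F \ B, marginal v S g ≤ μ / 3 := by
      intro g hg
      have hg' : v {g} < μ / 3 := by simpa [hB] using (Finset.mem_sdiff.1 hg).2
      have := hv.marginal_anti (Finset.empty_subset S) g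
      simp only [marginal, insert_empty_eq, hv.empty] at this ⊢
      linarith
    refine (Finset.sum_le_card_nsmul _ _ _ hle).trans ?_
    rw [nsmul_eq_mul]
    refine mul_le_mul_of_nonneg_right ?_ hμ0
    have : (F \ B).card ≤ n - k := by
      rw [Finset.card_sdiff_of_subset hBF]; omega
    exact_mod_cast this
  -- Enlarging n - k to |J| makes |J| a common factor that cancels.
  have h6 : (J.card : ℝ) * μ ≤ J.card * (2 * v S + μ / 3) := by
    have : ((n - k : ℕ) : ℝ) * (v S + μ / 3) ≤ J.card * (v S + μ / 3) :=
      mul_le_mul_of_nonneg_right hcast (add_nonneg (hv.nonneg S) hμ0)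
    linarith
  have := le_of_mul_le_mul_left h6 (hpos.trans_le hcast)
  linarith

end

end FairDivision

namespace FairDivision

/-! ## Total correctness of programs -/

/-- The program `p`, started with memory `s`, halts after at most `T` steps with a memory that
satisfies `Q`. -/
def Achieves {m : ℕ} (v : Finset (Fin m) → ℝ) (p : Program) (s : Memory) (T : ℕ)
    (Q : Memory → Prop) : Prop :=
  ∃ s' t, Runs v p s s' t ∧ t ≤ T ∧ Q s'

namespace Memory

@[simp] theorem nat_setNat_self (s : Memory) (a i x : ℕ) :
    (s.setNat a i x).nat a = Function.update (s.nat a) i x := by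
  simp [setNat]

@[simp] theorem nat_setNat_of_ne (s : Memory) {a b : ℕ} (i x : ℕ) (h : b ≠ a) :
    (s.setNat a i x).nat b = s.nat b := by
  simp [setNat, h]

@[simp] theorem real_setNat (s : Memory) (a i x : ℕ) : (s.setNat a i x).real = s.real := rfl

@[simp] theorem nat_setReal (s : Memory) (a i : ℕ) (x : ℝ) : (s.setReal a i x).nat = s.nat := rfl

@[simp] theorem real_setReal_self (s : Memory) (a i : ℕ) (x : ℝ) :
    (s.setReal a i x).real a = Function.update (s.real a) i x := by
  simp [setReal]

@[simp] theorem real_setReal_of_ne (s : Memory) {a b : ℕ} (i : ℕ) (x : ℝ) (h : b ≠ a) :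
    (s.setReal a i x).real b = s.real b := by
  simp [setReal, h]

end Memory

section
variable {m : ℕ} {v : Finset (Fin m) → ℝ} {p q : Program} {s : Memory} {Q R : Memory → Prop}

theorem Achieves.mono {T T' : ℕ} (h : Achieves v p s T Q) (hT : T ≤ T')
    (hQ : ∀ s', Q s' → R s') : Achieves v p s T' R := by
  obtain ⟨s', t, hr, ht, hq⟩ := h
  exact ⟨s', t, hr, ht.trans hT, hQ s' hq⟩

theorem Achieves.skip (h : Q s) : Achieves v .skip s 1 Q := ⟨_, _, .skip s, le_rfl, h⟩

theorem Achieves.setNat {a : ℕ} {i e : NatExpr} (h : Q (s.setNat a (i.eval s) (e.eval s))) :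
    Achieves v (.setNat a i e) s (i.cost + e.cost + 1) Q :=
  ⟨_, _, .setNat s a i e, le_rfl, h⟩

theorem Achieves.setReal {a : ℕ} {i : NatExpr} {e : RealExpr}
    (h : Q (s.setReal a (i.eval s) (e.eval v s))) :
    Achieves v (.setReal a i e) s (i.cost + e.cost + 1) Q :=
  ⟨_, _, .setReal s a i e, le_rfl, h⟩

theorem Achieves.seq {T T' : ℕ}
    (h : Achieves v p s T fun s' => Achieves v q s' T' Q) :
    Achieves v (.seq p q) s (T + T') Q := by
  obtain ⟨s', t, hr, ht, s'', t', hr', ht', hq⟩ := h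
  exact ⟨s'', t + t', .seq hr hr', by omega, hq⟩

/-- Charging for both branches avoids a maximum in the step bounds. -/
theorem Achieves.ite {T T' : ℕ} {b : Test} (h : b.Holds v s → Achieves v p s T Q)
    (h' : ¬ b.Holds v s → Achieves v q s T' Q) :
    Achieves v (.ite b p q) s (b.cost + (T + T')) Q := by
  by_cases hb : b.Holds v s
  · obtain ⟨s', t, hr, ht, hq⟩ := h hb
    exact ⟨s', _, .ite_true hb hr, by omega, hq⟩
  · obtain ⟨s', t, hr, ht, hq⟩ := h' hb
    exact ⟨s', _, .ite_false hb hr, by omega, hq⟩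

end

/-- Entry `0` of an array of natural numbers, used as a variable. -/
def NatExpr.var (a : ℕ) : NatExpr := .get a (.const 0)

/-- Entry `0` of an array of real numbers, used as a variable. -/
def RealExpr.var (a : ℕ) : RealExpr := .get a (.const 0)

/-- Execute `p` for the values `0, 1, …` of the variable `c` below the value of the variable `b`. -/
def Program.forLoop (c b : ℕ) (p : Program) : Program :=
  .seq (.setNat c (.const 0) (.const 0))
    (.loop (.neg (.natLe (.var b) (.var c)))
      (.seq p (.setNat c (.const 0) (.add (.var c) (.const 1)))))

/-- The invariant at j is stated for the memory whose counter is already j. The 12 consists of 6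
steps for the test and 6 for the increment; the extra round in N + 1 pays for the initialization and
the last, failing test. -/
theorem Achieves.forLoop {m : ℕ} {v : Finset (Fin m) → ℝ} {p : Program} {s : Memory}
    {c b N T : ℕ} (I : ℕ → Memory → Prop) (h0 : I 0 (s.setNat c 0 0))
    (hN : ∀ j s', I j s' → s'.nat b 0 = N)
    (hstep : ∀ j s', j < N → s'.nat c 0 = j → I j s' →
      Achieves v p s' T fun s'' => s''.nat c 0 = j ∧ I (j + 1) (s''.setNat c 0 (j + 1))) :
    Achieves v (.forLoop c b p) s ((N + 1) * (T + 12)) (I N) := by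
  have main : ∀ r j s', j + r = N → s'.nat c 0 = j → I j s' →
      Achieves v (.loop (.neg (.natLe (.var b) (.var c)))
        (.seq p (.setNat c (.const 0) (.add (.var c) (.const 1))))) s' (r * (T + 12) + 6)
        (I N) := by
    intro r
    induction r with
    | zero =>
      intro j s' hj hc hI
      refine ⟨s', _, .loop_done ?_, ?_, by rwa [← hj]⟩
      · simp only [Test.Holds, NatExpr.var, NatExpr.eval, hN j s' hI, hc]
        omega
      · simp [Test.cost, NatExpr.var, NatExpr.cost]
    | succ r ih =>
      intro j s' hj hc hI
      obtain ⟨s₁, t₁, hr₁, ht₁, hc₁, hI₁⟩ := hstep j s' (by omega) hc hI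
      obtain ⟨s₂, t₂, hr₂, ht₂, hI₂⟩ :=
        ih (j + 1) (s₁.setNat c 0 (j + 1)) (by omega) (by simp) hI₁
      have hset : Runs v (.setNat c (.const 0) (.add (.var c) (.const 1))) s₁
          (s₁.setNat c 0 (j + 1)) 6 := by
        have := Runs.setNat (v := v) s₁ c (.const 0) (.add (.var c) (.const 1))
        simpa [NatExpr.eval, NatExpr.var, NatExpr.cost, hc₁] using this
      refine ⟨s₂, _, .loop_step ?_ (.seq hr₁ hset) hr₂, ?_, hI₂⟩
      · simp only [Test.Holds, NatExpr.var, NatExpr.eval, hN j s' hI, hc]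
        omega
      · simp only [Test.cost, NatExpr.var, NatExpr.cost]
        rw [Nat.succ_mul]
        omega
  obtain ⟨s', t, hr, ht, hI⟩ := main N 0 (s.setNat c 0 0) (by omega) (by simp) h0
  refine ⟨s', _, .seq (.setNat _ _ _ _) hr, ?_, hI⟩
  simp only [NatExpr.cost]
  rw [Nat.succ_mul]
  omega

end FairDivision

namespace FairDivision

/-! ## The algorithm

Memory: the variables `4` (number `k` of bundles with a single turn), `5` (turn), `6` (good),
`7` (best good), `8` (bundle whose turn it is), `9` (bundle) and the labels of the goods in the
array `3`; the real variables `1` (value with the best good) and `2` (least value of a bundle). -/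

/-- Find the unassigned good with the greatest marginal value for the bundle whose turn it is. -/
def searchProgram : Program :=
  .seq (.setReal 1 (.const 0) (.const (-1)))
    (.forLoop 6 1
      (.ite (.natLe (.var 0) (.get 3 (.var 6)))
        (.seq (.setNat 3 (.var 6) (.var 8))
          (.seq
            (.ite (.realLe (.value 3 (.var 8)) (.var 1)) .skip
              (.seq (.setReal 1 (.const 0) (.value 3 (.var 8)))
                (.setNat 7 (.const 0) (.var 6))))
            (.setNat 3 (.var 6) (.var 0))))
        .skip))

/-- One turn of the round robin. -/
def turnProgram : Program :=
  .seq searchProgram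
    (.seq (.setNat 3 (.var 7) (.var 8))
      (.ite (.natLe (.var 0) (.add (.var 8) (.const 1)))
        (.setNat 8 (.const 0) (.var 4))
        (.setNat 8 (.const 0) (.add (.var 8) (.const 1)))))

/-- The round robin. -/
def roundRobinProgram : Program :=
  .seq (.forLoop 6 1 (.setNat 3 (.var 6) (.var 0)))
    (.seq (.setNat 8 (.const 0) (.const 0)) (.forLoop 5 1 turnProgram))

/-- Compute the least value of a bundle. -/
def leastProgram : Program :=
  .seq (.setReal 2 (.const 0) (.value 3 (.const 0)))
    (.forLoop 9 0
      (.ite (.realLe (.var 2) (.value 3 (.var 9))) .skip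
        (.setReal 2 (.const 0) (.value 3 (.var 9)))))

/-- Keep the present labels if they are better than the best ones before. -/
def updateProgram : Program :=
  .ite (.realLe (.var 2) (.var 0)) .skip
    (.seq (.setReal 0 (.const 0) (.var 2))
      (.forLoop 6 1 (.setNat 2 (.var 6) (.get 3 (.var 6)))))

/-- Return the best one of the round robins. -/
def maximinProgram : Program :=
  .seq (.setReal 0 (.const 0) (.const (-1)))
    (.forLoop 4 0 (.seq roundRobinProgram (.seq leastProgram updateProgram)))

/-! ### Correctness and cost of the subprograms -/

section
variable {m n : ℕ} {v : Finset (Fin m) → ℝ}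

/-- The labels of the goods that are stored in an array. -/
def labels (m : ℕ) (A : ℕ → ℕ) : Fin m → ℕ := fun j => A j

theorem labels_update (A : ℕ → ℕ) (g : Fin m) (x : ℕ) :
    labels m (Function.update A g x) = Function.update (labels m A) g x := by
  ext j
  by_cases h : j = g
  · subst h; simp [labels]
  · have : (j : ℕ) ≠ g := fun h' => h (Fin.ext h')
    simp [labels, h, this]

theorem goods_eq_bundle (s : Memory) (a k : ℕ) :
    s.goods m a k = bundle (labels m (s.nat a)) k := rfl

/-- The loop invariant: either no unassigned good has been seen and the record is still -1, or the
record is the value with the best good seen so far. The oracle only evaluates label classes, so each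
candidate is given the label p for the query and then n again. -/
theorem achieves_searchProgram (hv : IsSubmodularValuation v) {s : Memory} {p : ℕ}
    (hn : s.nat 0 0 = n) (hm : s.nat 1 0 = m) (hp : s.nat 8 0 = p)
    (hL : ∀ g, labels m (s.nat 3) g ≤ n) (hex : ∃ g, labels m (s.nat 3) g = n) :
    Achieves v searchProgram s ((m + 1) * 50 + 3) fun s' =>
      (∀ a, a ≠ 6 → a ≠ 7 → s'.nat a = s.nat a) ∧ s'.real 0 = s.real 0 ∧
      ∃ g : Fin m, s'.nat 7 0 = g ∧ labels m (s.nat 3) g = n ∧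
        ∀ g', labels m (s.nat 3) g' = n →
          v (insert g' (bundle (labels m (s.nat 3)) p)) ≤
            v (insert g (bundle (labels m (s.nat 3)) p)) := by
  set L := labels m (s.nat 3) with hLdef
  let I : ℕ → Memory → Prop := fun j s' =>
    (∀ a, a ≠ 6 → a ≠ 7 → s'.nat a = s.nat a) ∧ s'.real 0 = s.real 0 ∧
    ((s'.real 1 0 = -1 ∧ ∀ g : Fin m, g < j → L g ≠ n) ∨
      ∃ g : Fin m, s'.nat 7 0 = g ∧ L g = n ∧ s'.real 1 0 = v (insert g (bundle L p)) ∧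
        ∀ g' : Fin m, g' < j → L g' = n → v (insert g' (bundle L p)) ≤ s'.real 1 0)
  have hloop : Achieves v searchProgram s (3 + (m + 1) * (38 + 12)) (I m) := by
    refine Achieves.seq (T := 3) (Achieves.setReal (Achieves.forLoop (N := m) I ?_ ?_ ?_))
    · refine ⟨fun a h6 h7 => by simp [h6], by simp,
        Or.inl ⟨by simp [RealExpr.eval, NatExpr.eval], fun g hg => ?_⟩⟩
      omega
    · intro j s' hI
      rw [hI.1 1 (by decide) (by decide), hm]
    · intro j s' hj hc hI
      obtain ⟨hfr, hr0, hbest⟩ := hI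
      have e0 : s'.nat 0 0 = n := by rw [hfr 0 (by decide) (by decide), hn]
      have e3 : s'.nat 3 = s.nat 3 := hfr 3 (by decide) (by decide)
      have e8 : s'.nat 8 0 = p := by rw [hfr 8 (by decide) (by decide), hp]
      let g : Fin m := ⟨j, hj⟩
      have hval : (s'.setNat 3 j p).goods m 3 p = insert g (bundle L p) := by
        rw [goods_eq_bundle, Memory.nat_setNat_self, e3, show j = (g : ℕ) from rfl, labels_update,
          bundle_update_self]
      refine Achieves.mono (T := _) (Achieves.ite (fun hb => Achieves.seq (Achieves.setNat
        (Achieves.seq (Achieves.ite (fun hle => Achieves.skip (Achieves.setNat ?_))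
          (fun hle => Achieves.seq (Achieves.setReal
            (Achieves.setNat (Achieves.setNat ?_))))))))
        (fun hb => Achieves.skip ?_)) (Nat.le_of_ble_eq_true rfl) (fun _ h => h)
      · simp only [Test.Holds, NatExpr.eval, NatExpr.var, e0, hc, e3] at hb
        have hg : s.nat 3 j = n := le_antisymm (hL g) hb
        -- The trial label is undone exactly, because the label was n before.
        have harr : Function.update (Function.update (s.nat 3) j p) j n = s.nat 3 := by
          rw [Function.update_idem, ← hg, Function.update_eq_self]
        simp [Test.Holds, RealExpr.eval, NatExpr.eval, NatExpr.var, RealExpr.var, hc, e8,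
          hval] at hle
        simp only [NatExpr.eval, NatExpr.var, hc]
        refine ⟨by simp [hc], fun a h6 h7 => ?_, by simpa using hr0, ?_⟩
        · by_cases h3 : a = 3
          · subst h3; simp [e0, e3, e8, hc, harr]
          · simp [h3, h6, hfr a h6 h7]
        · rcases hbest with ⟨h1, h2⟩ | ⟨g₀, h1, h2, h3, h4⟩
          -- The initial record -1 lies below every value, so the first unassigned good cannot fail
          -- to beat it.
          · have := hv.nonneg (insert g (bundle L p))
            linarith
          · refine Or.inr ⟨g₀, by simpa using h1, h2, by simpa using h3, fun g' hg' hL' => ?_⟩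
            rcases Nat.lt_succ_iff_lt_or_eq.1 hg' with h | h
            · simpa using h4 g' h hL'
            · have : g' = g := Fin.ext h
              subst this
              simpa using hle
      · simp only [Test.Holds, NatExpr.eval, NatExpr.var, e0, hc, e3] at hb
        have hg : s.nat 3 j = n := le_antisymm (hL g) hb
        have harr : Function.update (Function.update (s.nat 3) j p) j n = s.nat 3 := by
          rw [Function.update_idem, ← hg, Function.update_eq_self]
        simp [Test.Holds, RealExpr.eval, NatExpr.eval, NatExpr.var, RealExpr.var, hc, e8,
          hval] at hle
        simp only [NatExpr.eval, NatExpr.var, RealExpr.eval, hc]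
        refine ⟨by simp [hc], fun a h6 h7 => ?_, by simpa using hr0, Or.inr ⟨g, ?_, hg, ?_, ?_⟩⟩
        · by_cases h3 : a = 3
          · subst h3; simp [e0, e3, e8, hc, harr]
          · simp [h3, h6, h7, hfr a h6 h7]
        · simp [hc, g]
        · simp [e8, hc, hval]
        · intro g' hg' hL'
          simp only [Memory.real_setNat, Memory.real_setReal_self, Function.update_self,
            Memory.nat_setNat_of_ne s' j _ (by decide : (8 : ℕ) ≠ 3), e8, hval]
          rcases Nat.lt_succ_iff_lt_or_eq.1 hg' with h | h
          · rcases hbest with ⟨h1, h2⟩ | ⟨g₀, h1, h2, h3, h4⟩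
            · exact absurd hL' (h2 g' h)
            · linarith [h4 g' h hL']
          · have : g' = g := Fin.ext h
            subst this
            exact le_rfl
      · simp only [Test.Holds, NatExpr.eval, NatExpr.var, e0, hc, e3] at hb
        refine ⟨hc, fun a h6 h7 => by simp [h6, hfr a h6 h7], by simpa using hr0, ?_⟩
        have hne : ∀ g' : Fin m, g' < j + 1 → L g' = n → g' < j := by
          intro g' hg' hL'
          rcases Nat.lt_succ_iff_lt_or_eq.1 hg' with h | h
          · exact h
          · exact absurd (h ▸ hL'.ge : n ≤ s.nat 3 j) hb
        rcases hbest with ⟨h1, h2⟩ | ⟨g₀, h1, h2, h3, h4⟩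
        · exact Or.inl ⟨by simpa using h1, fun g' hg' hL' => h2 g' (hne g' hg' hL') hL'⟩
        · exact Or.inr ⟨g₀, by simpa using h1, h2, by simpa using h3, fun g' hg' hL' => by
            simpa using h4 g' (hne g' hg' hL') hL'⟩
  refine hloop.mono (by omega) fun s' ⟨hfr, hr0, hbest⟩ => ⟨hfr, hr0, ?_⟩
  rcases hbest with ⟨h1, h2⟩ | ⟨g₀, h1, h2, h3, h4⟩
  · obtain ⟨g, hg⟩ := hex
    exact absurd hg (h2 g g.2)
  · exact ⟨g₀, h1, h2, fun g' hL' => h3 ▸ h4 g' g'.2 hL'⟩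

theorem achieves_turnProgram (hv : IsSubmodularValuation v) {s : Memory} {k t p : ℕ} (hkn : k < n)
    (hn : s.nat 0 0 = n) (hm : s.nat 1 0 = m) (hk : s.nat 4 0 = k) (hp : s.nat 8 0 = p)
    (ht : t < m) (hR : RoundRobin v n k t (labels m (s.nat 3)) p) :
    Achieves v turnProgram s ((m + 1) * 50 + 30) fun s' =>
      (∀ a, a ≠ 3 → a ≠ 6 → a ≠ 7 → a ≠ 8 → s'.nat a = s.nat a) ∧ s'.real 0 = s.real 0 ∧
      RoundRobin v n k (t + 1) (labels m (s'.nat 3)) (s'.nat 8 0) := by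
  obtain ⟨hpn, hL, hc⟩ := hR.basic hkn
  have hex : ∃ g, labels m (s.nat 3) g = n := by
    obtain ⟨g, hg⟩ := Finset.card_pos.1 (by omega : 0 < (bundle (labels m (s.nat 3)) n).card)
    exact ⟨g, mem_bundle.1 hg⟩
  refine Achieves.mono (Achieves.seq (T' := 27) ((achieves_searchProgram hv hn hm hp hL hex).mono
    le_rfl ?_)) (by omega) fun _ h => h
  rintro s₁ ⟨hfr, hr0, g, hg, hgn, hmax⟩
  have e3 : s₁.nat 3 = s.nat 3 := hfr 3 (by decide) (by decide)
  have e8 : s₁.nat 8 0 = p := by rw [hfr 8 (by decide) (by decide), hp]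
  have e0 : s₁.nat 0 0 = n := by rw [hfr 0 (by decide) (by decide), hn]
  have e4 : s₁.nat 4 0 = k := by rw [hfr 4 (by decide) (by decide), hk]
  have hturn := hR.turn g hgn hmax
  refine Achieves.mono (Achieves.seq (Achieves.setNat (Achieves.ite (fun hb => Achieves.setNat ?_)
    (fun hb => Achieves.setNat ?_)))) (Nat.le_of_ble_eq_true rfl) fun _ h => h
  all_goals
    simp [Test.Holds, NatExpr.eval, NatExpr.var, e0, e8] at hb
    refine ⟨fun a h3 h6 h7 h8 => by simp [h3, h8, hfr a h6 h7], by simpa using hr0, ?_⟩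
  · rw [if_pos hb] at hturn
    simpa [NatExpr.eval, NatExpr.var, e3, e4, e8, hg, labels_update] using hturn
  · rw [if_neg (by omega)] at hturn
    simpa [NatExpr.eval, NatExpr.var, e3, e4, e8, hg, labels_update] using hturn

theorem achieves_roundRobinProgram (hv : IsSubmodularValuation v) {s : Memory} {k : ℕ}
    (hkn : k < n) (hn : s.nat 0 0 = n) (hm : s.nat 1 0 = m) (hk : s.nat 4 0 = k) :
    Achieves v roundRobinProgram s ((m + 1) * 17 + 3 + (m + 1) * ((m + 1) * 50 + 42))
      fun s' => (∀ a < 3, s'.nat a = s.nat a) ∧ s'.nat 4 = s.nat 4 ∧ s'.real 0 = s.real 0 ∧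
        ∃ p, RoundRobin v n k m (labels m (s'.nat 3)) p := by
  let I : ℕ → Memory → Prop := fun j s' =>
    (∀ a, a ≠ 3 → a ≠ 6 → s'.nat a = s.nat a) ∧ s'.real 0 = s.real 0 ∧ ∀ g < j, s'.nat 3 g = n
  have hfill : Achieves v (.forLoop 6 1 (.setNat 3 (.var 6) (.var 0))) s ((m + 1) * (5 + 12))
      (I m) := by
    refine Achieves.forLoop (N := m) I ⟨fun a h3 h6 => by simp [h6], by simp, by simp⟩ ?_ ?_
    · intro j s' hI
      rw [hI.1 1 (by decide) (by decide), hm]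
    · intro j s' hj hc ⟨hfr, hr0, h3⟩
      have e0 : s'.nat 0 0 = n := by rw [hfr 0 (by decide) (by decide), hn]
      refine Achieves.setNat ⟨by simpa using hc, fun a h3 h6 => by simp [h3, h6, hfr a h3 h6],
        by simpa using hr0, fun g hg => ?_⟩
      by_cases hgj : g = j
      · simp [NatExpr.eval, NatExpr.var, hc, hgj, e0]
      · simp [NatExpr.eval, NatExpr.var, hc, hgj, h3 g (by omega)]
  let J : ℕ → Memory → Prop := fun j s' =>
    (∀ a, a ≠ 3 → a ≠ 5 → a ≠ 6 → a ≠ 7 → a ≠ 8 → s'.nat a = s.nat a) ∧ s'.real 0 = s.real 0 ∧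
      RoundRobin v n k j (labels m (s'.nat 3)) (s'.nat 8 0)
  refine Achieves.mono (T := (m + 1) * (5 + 12) + (3 + (m + 1) * ((m + 1) * 50 + 30 + 12)))
    (Achieves.seq (hfill.mono le_rfl fun s₁ hI => Achieves.seq
    (Achieves.setNat (Achieves.forLoop (N := m) (T := (m + 1) * 50 + 30) J ?_ ?_ ?_))))
    (le_of_eq (by ring)) (Q := J m) ?_
  · obtain ⟨hfr, hr0, h3⟩ := hI
    refine ⟨fun a h3 h5 h6 h7 h8 => by simp [h5, h8, hfr a h3 h6], by simpa using hr0, ?_⟩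
    have : labels m (s₁.nat 3) = fun _ => n := funext fun g => h3 g g.2
    simpa [NatExpr.eval, this] using RoundRobin.start (v := v) (n := n) (k := k)
  · intro j s' hJ
    rw [hJ.1 1 (by decide) (by decide) (by decide) (by decide) (by decide), hm]
  · rintro j s' hj hc ⟨hfr, hr0, hR⟩
    refine (achieves_turnProgram hv hkn ?_ ?_ ?_ rfl hj hR).mono le_rfl ?_
    · rw [hfr 0 (by decide) (by decide) (by decide) (by decide) (by decide), hn]
    · rw [hfr 1 (by decide) (by decide) (by decide) (by decide) (by decide), hm]
    · rw [hfr 4 (by decide) (by decide) (by decide) (by decide) (by decide), hk]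
    · rintro s₂ ⟨hfr₂, hr₂, hR₂⟩
      refine ⟨by rw [hfr₂ 5 (by decide) (by decide) (by decide) (by decide), hc],
        fun a h3 h5 h6 h7 h8 => ?_, ?_, ?_⟩
      · simp [h5, hfr₂ a h3 h6 h7 h8, hfr a h3 h5 h6 h7 h8]
      · simp [hr₂, hr0]
      · simpa using hR₂
  · rintro s' ⟨hfr, hr0, hR⟩
    refine ⟨fun a ha => hfr a ?_ ?_ ?_ ?_ ?_, hfr 4 ?_ ?_ ?_ ?_ ?_, hr0, _, hR⟩ <;> omega

/-- Starting from the value of bundle 0, which exists since 1 ≤ n, makes an infinite initial value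
unnecessary. -/
theorem achieves_leastProgram {s : Memory} (hn : s.nat 0 0 = n) (hn1 : 1 ≤ n) :
    Achieves v leastProgram s (4 + (n + 1) * 26) fun s' =>
      (∀ a, a ≠ 9 → s'.nat a = s.nat a) ∧ s'.real 0 = s.real 0 ∧
      (∀ i < n, s'.real 2 0 ≤ v (bundle (labels m (s.nat 3)) i)) ∧
      ∀ τ, (∀ i < n, τ ≤ v (bundle (labels m (s.nat 3)) i)) → τ ≤ s'.real 2 0 := by
  let I : ℕ → Memory → Prop := fun j s' =>
    (∀ a, a ≠ 9 → s'.nat a = s.nat a) ∧ s'.real 0 = s.real 0 ∧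
      (∀ i < j, s'.real 2 0 ≤ v (bundle (labels m (s.nat 3)) i)) ∧
      ∀ τ, (∀ i < n, τ ≤ v (bundle (labels m (s.nat 3)) i)) → τ ≤ s'.real 2 0
  refine Achieves.seq (T := 4) (T' := (n + 1) * (14 + 12)) (Achieves.setReal
    (Achieves.forLoop (N := n) I ⟨fun a h9 => by simp [h9], by simp, by simp, fun τ hτ => ?_⟩ ?_ ?_))
  · simpa [RealExpr.eval, NatExpr.eval, goods_eq_bundle] using hτ 0 hn1
  · intro j s' hI
    rw [hI.1 0 (by decide), hn]
  · rintro j s' hj hc ⟨hfr, hr0, h1, h2⟩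
    have e3 : s'.nat 3 = s.nat 3 := hfr 3 (by decide)
    refine Achieves.mono (Achieves.ite (fun hb => Achieves.skip ?_)
      (fun hb => Achieves.setReal ?_)) (Nat.le_of_ble_eq_true rfl) fun _ h => h
    all_goals
      simp [Test.Holds, RealExpr.eval, RealExpr.var, NatExpr.eval, NatExpr.var, hc,
        goods_eq_bundle, e3] at hb
      refine ⟨by simpa using hc, fun a h9 => by simp [h9, hfr a h9], by simpa using hr0, ?_, ?_⟩
    · intro i hi
      rcases Nat.lt_succ_iff_lt_or_eq.1 hi with h | rfl
      · simpa using h1 i h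
      · simpa using hb
    · simpa using h2
    · intro i hi
      simp only [Memory.real_setNat, Memory.real_setReal_self, NatExpr.eval, RealExpr.eval,
        NatExpr.var, hc, goods_eq_bundle, e3, Function.update_self]
      rcases Nat.lt_succ_iff_lt_or_eq.1 hi with h | rfl
      · exact hb.le.trans (h1 i h)
      · exact le_rfl
    · intro τ hτ
      simpa [NatExpr.eval, RealExpr.eval, NatExpr.var, hc, goods_eq_bundle, e3] using hτ j hj

theorem achieves_updateProgram {s : Memory} (hm : s.nat 1 0 = m) :
    Achieves v updateProgram s (10 + (m + 1) * 19) fun s' =>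
      (∀ a, a ≠ 2 → a ≠ 6 → s'.nat a = s.nat a) ∧
      ((s.real 2 0 ≤ s.real 0 0 ∧ s'.real 0 = s.real 0 ∧ s'.nat 2 = s.nat 2) ∨
        (s.real 0 0 < s.real 2 0 ∧ s'.real 0 0 = s.real 2 0 ∧
          labels m (s'.nat 2) = labels m (s.nat 3))) := by
  let I : ℕ → Memory → Prop := fun j s' =>
    (∀ a, a ≠ 2 → a ≠ 6 → s'.nat a = s.nat a) ∧ s'.real 0 0 = s.real 2 0 ∧
      ∀ g < j, s'.nat 2 g = s.nat 3 g
  refine Achieves.mono (Achieves.ite (fun hb => Achieves.skip ?_)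
    (fun hb => Achieves.seq (T' := (m + 1) * (7 + 12)) (Achieves.setReal (Achieves.mono
      (Achieves.forLoop (N := m) (T := 7) I ?_ ?_ ?_) le_rfl ?_))))
    (by simp only [Test.cost, RealExpr.cost, NatExpr.cost, RealExpr.var]; omega) fun _ h => h
  · simp [Test.Holds, RealExpr.eval, RealExpr.var, NatExpr.eval] at hb
    exact ⟨fun _ _ _ => rfl, Or.inl ⟨hb, rfl, rfl⟩⟩
  · exact ⟨fun a h2 h6 => by simp [h6], by simp [RealExpr.eval, RealExpr.var, NatExpr.eval], by simp⟩
  · intro j s' hI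
    rw [hI.1 1 (by decide) (by decide), hm]
  · rintro j s' hj hc ⟨hfr, hr0, h2⟩
    have e3 : s'.nat 3 = s.nat 3 := hfr 3 (by decide) (by decide)
    refine Achieves.mono (Achieves.setNat ?_) (Nat.le_of_ble_eq_true rfl) fun _ h => h
    refine ⟨by simpa using hc, fun a h2 h6 => by simp [h2, h6, hfr a h2 h6],
      by simpa using hr0, fun g hg => ?_⟩
    by_cases hgj : g = j
    · simp [NatExpr.eval, NatExpr.var, hc, hgj, e3]
    · simp [NatExpr.eval, NatExpr.var, hc, hgj, h2 g (by omega)]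
  · simp [Test.Holds, RealExpr.eval, RealExpr.var, NatExpr.eval] at hb
    rintro s' ⟨hfr, hr0, h2⟩
    exact ⟨hfr, Or.inr ⟨hb, hr0, funext fun g => h2 g g.2⟩⟩

/-- The last clause quantifies over all round robins for k, so it does not depend on how ties are
broken, and τ and k need not be known to the program. The value -1 marks that nothing has been
stored yet. -/
theorem achieves_maximinProgram (hv : IsSubmodularValuation v) (hn : 1 ≤ n) :
    Achieves v maximinProgram (Memory.initial n m)
      (3 + (n + 1) * ((m + 1) * 17 + 3 + (m + 1) * ((m + 1) * 50 + 42) +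
        (4 + (n + 1) * 26 + (10 + (m + 1) * 19)) + 12)) fun s' =>
      (s'.real 0 0 = -1 ∨ (∀ g, labels m (s'.nat 2) g < n) ∧
        ∀ i < n, s'.real 0 0 ≤ v (bundle (labels m (s'.nat 2)) i)) ∧
      ∀ τ, ∀ k < n, (∀ L p, RoundRobin v n k m L p → ∀ i < n, τ ≤ v (bundle L i)) →
        τ ≤ s'.real 0 0 := by
  let I : ℕ → Memory → Prop := fun j s' =>
    s'.nat 0 0 = n ∧ s'.nat 1 0 = m ∧ (s'.real 0 0 = -1 ∨ (∀ g, labels m (s'.nat 2) g < n) ∧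
        ∀ i < n, s'.real 0 0 ≤ v (bundle (labels m (s'.nat 2)) i)) ∧
      ∀ τ, ∀ k < j, (∀ L p, RoundRobin v n k m L p → ∀ i < n, τ ≤ v (bundle L i)) →
        τ ≤ s'.real 0 0
  refine Achieves.seq (T := 3) (Achieves.setReal (Achieves.mono (Achieves.forLoop (N := n) I
    ?_ ?_ ?_) le_rfl fun s' hI => hI.2.2))
  · exact ⟨by simp [Memory.initial], by simp [Memory.initial],
      Or.inl (by simp [RealExpr.eval, NatExpr.eval]), fun τ k hk => absurd hk (by omega)⟩
  · exact fun j s' hI => hI.1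
  · rintro j s hj hc ⟨h0, h1, hbest, hτ⟩
    refine Achieves.seq ((achieves_roundRobinProgram hv hj h0 h1 hc).mono le_rfl ?_)
    rintro s₁ ⟨hfr₁, h4₁, hr₁, p, hR⟩
    have h0₁ : s₁.nat 0 0 = n := by rw [hfr₁ 0 (by decide), h0]
    refine Achieves.seq ((achieves_leastProgram h0₁ hn).mono le_rfl ?_)
    rintro s₂ ⟨hfr₂, hr₂, hle, hge⟩
    have h1₂ : s₂.nat 1 0 = m := by rw [hfr₂ 1 (by decide), hfr₁ 1 (by decide), h1]
    refine (achieves_updateProgram h1₂).mono le_rfl ?_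
    rintro s₃ ⟨hfr₃, hupd⟩
    have e3 : s₂.nat 3 = s₁.nat 3 := hfr₂ 3 (by decide)
    have e2 : s₂.nat 2 = s.nat 2 := by rw [hfr₂ 2 (by decide), hfr₁ 2 (by decide)]
    have er : s₂.real 0 = s.real 0 := hr₂.trans hr₁
    have hstep : ∀ τ, (∀ L p, RoundRobin v n j m L p → ∀ i < n, τ ≤ v (bundle L i)) →
        τ ≤ s₂.real 2 0 := fun τ h => hge τ (h _ p hR)
    refine ⟨?_, ?_, ?_, ?_, ?_⟩
    · rw [hfr₃ 4 (by decide) (by decide), hfr₂ 4 (by decide), h4₁, hc]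
    · simp [hfr₃ 0, hfr₂ 0, h0₁]
    · simp [hfr₃ 1, h1₂]
    · rcases hupd with ⟨-, hr, h2⟩ | ⟨-, hr, h2⟩
      · simpa [hr, er, h2, e2] using hbest
      · obtain ⟨hp, hL, hcard⟩ := hR.basic hj
        refine Or.inr ⟨?_, ?_⟩
        · intro g
          rw [Memory.nat_setNat_of_ne _ _ _ (by decide), h2, e3]
          refine lt_of_le_of_ne (hL g) fun h => ?_
          have := Finset.card_pos.2 ⟨g, mem_bundle.2 h⟩
          omega
        · simpa [hr, h2, e3] using hle
    · intro τ k hk h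
      rw [Memory.real_setNat]
      rcases Nat.lt_succ_iff_lt_or_eq.1 hk with hk | rfl
      · have := hτ τ k hk h
        rcases hupd with ⟨-, hr, -⟩ | ⟨hlt, hr, -⟩
        · rwa [hr, er]
        · rw [er] at hlt; linarith
      · have := hstep τ h
        rcases hupd with ⟨hle', hr, -⟩ | ⟨-, hr, -⟩
        · rw [hr]; linarith
        · rwa [hr]

end

end FairDivision

/-! ### The approximation theorem -/

theorem mainTheorem6 :
    ∃ (prog : FairDivision.Program) (poly : Polynomial ℕ),
      ∀ (n m : ℕ), 1 ≤ n → ∀ v : Finset (Fin m) → ℝ, FairDivision.IsSubmodularValuation v →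
        ∃ (s : FairDivision.Memory) (t : ℕ),
          -- the program halts in polynomial time
          FairDivision.Runs v prog (FairDivision.Memory.initial n m) s t ∧
          t ≤ poly.eval (n + m) ∧
          -- it returns a partition into `n` bundles of value at least one ninth of the share
          FairDivision.IsPartition Finset.univ (s.bundles n m) ∧
          (∀ i : Fin n,
            1 / 9 * FairDivision.maximinShare v n Finset.univ ≤ v (s.bundles n m i)) ∧
          -- it returns a number that approximates the maximin share
          1 / 9 * FairDivision.maximinShare v n Finset.univ ≤ s.number ∧
          s.number ≤ FairDivision.maximinShare v n Finset.univ ∧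
          -- the partition is a fair allocation for agents who all have the valuation `v`
          FairDivision.IsApproxMaximinFair (1 / 9) (fun _ : Fin n => v) (s.bundles n m) := by
  refine ⟨FairDivision.maximinProgram, 3 + (.X + 1) * ((.X + 1) * 17 + 3 +
    (.X + 1) * ((.X + 1) * 50 + 42) + (4 + (.X + 1) * 26 + (10 + (.X + 1) * 19)) + 12),
    fun n m hn v hv => ?_⟩
  obtain ⟨s, t, hr, ht, hbest, hτ⟩ := FairDivision.achieves_maximinProgram (m := m) hv hn
  have hgreat := FairDivision.maximinShare_isGreatest hn v (Finset.univ : Finset (Fin m))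
  set μ := FairDivision.maximinShare v n (Finset.univ : Finset (Fin m))
  obtain ⟨M, hM, hμ⟩ := hgreat.1
  have hne : Nonempty (Fin n) := ⟨⟨0, hn⟩⟩
  have hμ0 : 0 ≤ μ := hμ ▸ le_ciInf fun j => hv.nonneg _
  have hμM : ∀ j, μ ≤ v (M j) := fun j => hμ ▸ ciInf_le (Set.finite_range _).bddBelow j
  have hlow : μ / 3 ≤ s.number :=
    hτ (μ / 3) (min (Finset.univ.filter fun g : Fin m => μ / 3 ≤ v {g}).card (n - 1))
      (by omega) fun L p hR i hi => hR.share_le hv hM.1 hμM hn rfl hi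
  -- The number is at least μ/3 ≥ 0, so it is not the initial -1 and a labelling has been stored.
  obtain ⟨hlab, hval⟩ := hbest.resolve_left fun h => by
    have : s.number = -1 := h
    linarith
  have hpart : FairDivision.IsPartition Finset.univ (s.bundles n m) := by
    refine ⟨fun i j hij => Finset.disjoint_left.2 fun g hg hg' => hij ?_, ?_⟩
    · exact Fin.ext ((FairDivision.mem_bundle.1 hg).symm.trans (FairDivision.mem_bundle.1 hg'))
    · refine Finset.eq_univ_of_forall fun g => Finset.mem_biUnion.2
        ⟨⟨_, hlab g⟩, Finset.mem_univ _, FairDivision.mem_bundle.2 rfl⟩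
  have hnum : ∀ i : Fin n, s.number ≤ v (s.bundles n m i) := fun i => hval i i.2
  have hshare : ∀ i : Fin n, 1 / 9 * μ ≤ v (s.bundles n m i) := fun i => by
    have := hnum i
    linarith
  refine ⟨s, t, hr, ht.trans ?_, hpart, hshare, by linarith, ?_, hpart, hshare⟩
  · simp only [Polynomial.eval_add, Polynomial.eval_mul, Polynomial.eval_X, Polynomial.eval_one,
      Polynomial.eval_ofNat]
    -- The step bound is monotone in n and in m, so both may be replaced by n + m.
    gcongr <;> omega
  · exact (le_ciInf hnum).trans (hgreat.2 ⟨_, hpart, rfl⟩)
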